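/- Let $\mathcal X$ be a measurable space with a $\sigma$-finite reference measure $dx'$, let $B>0$, and let $D$ be a probability distribution of labelled examples $(x,y)\in\mathcal X\times\mathbb R$ (for example $\mathcal X\times[-B,B]$). For every $x\in\mathcal X$ let $N_x$ (the mirrored neighborhood distribution at $x$) be a probability distribution on $\mathcal X$ that depends measurably on $x$ and has a density $p_{N_x}$ with respect to $dx'$. Let $\mathcal G_{\mathrm{local}}$ be a class of functions $\mathcal X\to[-B,B]$, and let $\mathcal G$ be a class of jointly measurable explainers $g:\mathcal X\times\mathcal X\to[-B,B]$, written $g_{x'}(\cdot)=g(x',\cdot)$, such that $g_{x'}\in\mathcal G_{\mathrm{local}}$ for all $g\in\mathcal G$, $x'\in\mathcal X$. Let $f:\mathcal X\to[-B,B]$ be a fixed measurable function and put $$\mathsf{MNF}(f,g,x)=\mathbb E_{x'\sim N_x}\big[(f(x)-g_{x'}(x))^2\big],\qquad \mathsf{MNF}(f,g)=\mathbb E_{x\sim D}\big[\mathsf{MNF}(f,g,x)\big].$$ (Suprema over $g\in\mathcal G$ of linear combinations of $\mathsf{MNF}(f,g)$ and of the losses $\mathsf{MNF}(f,g,x_i)$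 at finitely many points are assumed to be measurable functions of the points, as is the case for countable $\mathcal G$.) For a sample $S=((x_1,y_1),\dots,(x_m,y_m))$ define the disjointedness factor $$\rho_S=\int_{\mathcal X}\sqrt{\frac1m\sum_{i=1}^m p_{N_{x_i}}(x')^2}\;dx'$$ and, for a nonempty set $T\subseteq\{1,\dots,m\}$ and $\sigma$ uniform on $\{-1,1\}^T$, $$\hat{\mathcal R}_T(\mathcal G_{\mathrm{local}})=\mathbb E_\sigma\Big[\sup_{h\in\mathcal G_{\mathrm{local}}}\frac1{|T|}\sum_{i\in T}\sigma_i h(x_i)\Big],\qquad \hat{\mathcal R}^*_S(\mathcal G_{\mathrm{local}})=\max_{\emptyset\ne T\subseteq\{1,\dots,m\}}\hat{\mathcal R}_T(\mathcal G_{\mathrm{local}})\sqrt{\frac{|T|}{m}}.$$ Then for every $m\ge1$ and $\delta\in(0,1)$, with probability at least $1-\delta$ over $S\sim D^m$, for all $g\in\mathcal G$ simultaneously, $$\mathsf{MNF}(f,g)\le\frac1m\sum_{i=1}^m\mathsf{MNF}(f,g,x_i)+8B\,\rho_S\,\hat{\mathcal R}^*_S(\mathcal G_{\mathrm{local}})\,(\ln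 m+1)+12B^2\sqrt{\frac{\ln(1/\delta)}{2m}}.$$ -/

import Mathlib

open MeasureTheory ProbabilityTheory
open scoped BigOperators

noncomputable section

/-- Pointwise mirrored neighborhood fidelity
`MNF(f, g, x) = 𝔼_{x' ∼ N_x} [(f x - g_{x'}(x))²]`. The kernel `N` gives the mirrored neighborhood
distributions; the explanation with source point `x'` is `g x' : X → ℝ`. -/
def mnfAt {X : Type*} [MeasurableSpace X] (N : Kernel X X) (f : X → ℝ) (g : X → X → ℝ)
    (x : X) : ℝ :=
  ∫ x', (f x - g x' x) ^ 2 ∂(N x)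

/-- (Test) mirrored neighborhood fidelity `MNF(f, g) = 𝔼_{x ∼ D} [MNF(f, g, x)]`, where `D` is a
distribution of labelled examples `(x, y)`. -/
def mnf {X : Type*} [MeasurableSpace X] (D : Measure (X × ℝ)) (N : Kernel X X) (f : X → ℝ)
    (g : X → X → ℝ) : ℝ :=
  ∫ z, mnfAt N f g z.1 ∂D

/-- Training mirrored neighborhood fidelity `(1/m) ∑ᵢ MNF(f, g, xᵢ)`. -/
def trainMnf {X : Type*} [MeasurableSpace X] {m : ℕ} (N : Kernel X X) (f : X → ℝ)
    (g : X → X → ℝ) (x : Fin m → X) : ℝ :=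
  (1 / (m : ℝ)) * ∑ i, mnfAt N f g (x i)

/-- The density `p_{N_x}` of the mirrored neighborhood distribution `N_x` with respect to the
reference measure `ν` of the input space (the `dx'` of integrals over the input space). -/
def nbhdDensity {X : Type*} [MeasurableSpace X] (N : Kernel X X) (ν : Measure X) (x x' : X) : ℝ :=
  ((N x).rnDeriv ν x').toReal

/-- The disjointedness factor `ρ_S = ∫ √((1/m) ∑ᵢ p_{N_{xᵢ}}(x')²) dx'`. -/
def disjointednessFactor {X : Type*} [MeasurableSpace X] {m : ℕ} (N : Kernel X X) (ν : Measure X)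
    (x : Fin m → X) : ℝ :=
  ∫ x', Real.sqrt ((1 / (m : ℝ)) * ∑ i, (nbhdDensity N ν (x i) x') ^ 2) ∂ν

/-- The empirical Rademacher complexity
`𝔼_σ [sup_{h ∈ H} (1/|ι|) ∑ᵢ σᵢ h(xᵢ)]` of a class `H` on the points `(xᵢ)_{i ∈ ι}`, where `σ` is
uniform on `{-1, 1}^ι` (`ℤˣ` is `{-1, 1}`). -/
def empRademacher {X ι : Type*} [Fintype ι] [DecidableEq ι] (H : Set (X → ℝ)) (x : ι → X) : ℝ :=
  (1 / (2 : ℝ) ^ Fintype.card ι) *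
    ∑ σ : ι → ℤˣ,
      ⨆ h : H, (1 / (Fintype.card ι : ℝ)) * ∑ i, ((σ i : ℤ) : ℝ) * (h : X → ℝ) (x i)

/-- The subset version of the empirical Rademacher complexity: the maximum over all nonempty
subsamples `T` of the sample of `√(|T|/m)` times the empirical Rademacher complexity on `T`.
Subsamples are given by their sets of indices. -/
def empRademacherStar {X : Type*} {m : ℕ} (H : Set (X → ℝ)) (x : Fin m → X) : ℝ :=
  ⨆ T : {T : Finset (Fin m) // T.Nonempty},
    empRademacher H (fun i : {i // i ∈ T.1} => x i) * Real.sqrt ((T.1.card : ℝ) / m)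

/-- The usual measurability convention for suprema over a possibly uncountable class (a measurable
class in the sense of empirical process theory), for the losses `x ↦ MNF(f, g, x)` with `g ∈ G`:
the supremum over `g` of any linear combination of the losses at finitely many points and of the
mean loss is a measurable function of the points. It holds for every countable `G`. -/
def MeasurableSuprema {X : Type*} [MeasurableSpace X] (D : Measure (X × ℝ)) (N : Kernel X X)
    (f : X → ℝ) (G : Set (X → X → ℝ)) : Prop :=
  ∀ (k : ℕ) (a₀ : ℝ) (a : Fin k → ℝ),
    Measurable fun x : Fin k → X =>
      ⨆ g : G, (a₀ * mnf D N f g + ∑ i, a i * mnfAt N f g (x i))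

end

/-! The losses `x ↦ MNF(f, g, x)` lie in `[0, 4B²]`, so the usual Rademacher bound
(`one_sub_le_measureReal_generalization`, from symmetrisation and McDiarmid) controls the mean by
the empirical mean, twice the empirical Rademacher average, and `3 · 4B² √(ln(1/δ)/(2m))`.

It remains to bound that average by the complexity of the local class (`signAverage_mnfAt_le`). Each
loss is `∫ p_i(x') (f(x_i) - g_{x'}(x_i))² dx'`. For fixed `x'` the function `g_{x'}` is a single
local function, so moving the supremum inside the integral leaves, for every `x'`, a Rademacher
average over the local class with weights `p_i(x') ≥ 0`. Contraction removes the square at the cost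
of `4B`.

The weighted average `W(p)` is sublinear in `p`. On the indicator of `T` it is `|T|` times the
Rademacher complexity on `T`, hence at most `√m R* √|T|`. Sorting `p` and writing it as a
nonnegative combination of indicators of its largest coordinates, Abel summation and Cauchy–Schwarz
against a harmonic sum give `W(p) ≤ √m R* ‖p‖₂ (ln m + 1)` (`sublinear_le_of_indicator_le`).
Integrating over `x'` turns `‖p‖₂` into `√m ρ_S`. -/

/-! ### Rademacher averages of bounded families -/

section SignAverage

variable {I ι : Type*} [Fintype ι]

/-- A signed sum of the coordinates of a vector. -/
def signedSum (σ : ι → ℤˣ) (v : ι → ℝ) : ℝ := ∑ i, ((σ i : ℤ) : ℝ) * v i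

/-- The Rademacher average `𝔼_σ [sup_h ∑ᵢ σᵢ a h i]` of a family of vectors. -/
noncomputable def signAverage [DecidableEq ι] (a : I → ι → ℝ) : ℝ :=
  (1 / (2 : ℝ) ^ Fintype.card ι) * ∑ σ : ι → ℤˣ, ⨆ h, signedSum σ (a h)

/-- All coordinates of all members of the family are bounded by one constant. -/
def UniformlyBounded {J : Type*} (a : I → J → ℝ) : Prop := ∃ C, ∀ h i, |a h i| ≤ C

lemma abs_units_cast (s : ℤˣ) : |((s : ℤ) : ℝ)| = 1 := by
  rcases Int.units_eq_one_or s with h | h <;> simp [h]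

lemma abs_signedSum_le (σ : ι → ℤˣ) (v : ι → ℝ) : |signedSum σ v| ≤ ∑ i, |v i| := by
  refine (Finset.abs_sum_le_sum_abs _ _).trans (Finset.sum_le_sum fun i _ => ?_)
  rw [abs_mul, abs_units_cast, one_mul]

lemma abs_signedSum_le_card_mul (σ : ι → ℤˣ) {v : ι → ℝ} {C : ℝ} (h : ∀ i, |v i| ≤ C) :
    |signedSum σ v| ≤ Fintype.card ι * C := by
  refine (abs_signedSum_le σ v).trans ?_
  refine (Finset.sum_le_sum fun i _ => h i).trans ?_
  simp

lemma bddAbove_signedSum {a : I → ι → ℝ} (ha : UniformlyBounded a) (σ : ι → ℤˣ) :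
    BddAbove (Set.range fun h => signedSum σ (a h)) := by
  obtain ⟨C, hC⟩ := ha
  refine ⟨Fintype.card ι * C, ?_⟩
  rintro _ ⟨h, rfl⟩
  exact (le_abs_self _).trans (abs_signedSum_le_card_mul σ (hC h))

lemma signedSum_add (σ : ι → ℤˣ) (v w : ι → ℝ) :
    signedSum σ (fun i => v i + w i) = signedSum σ v + signedSum σ w := by
  simp [signedSum, mul_add, Finset.sum_add_distrib]

lemma signedSum_mul_left (σ : ι → ℤˣ) (c : ℝ) (v : ι → ℝ) :
    signedSum σ (fun i => c * v i) = c * signedSum σ v := by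
  simp only [signedSum, Finset.mul_sum]
  exact Finset.sum_congr rfl fun i _ => by ring

lemma signedSum_neg_left (σ : ι → ℤˣ) (v : ι → ℝ) : signedSum (-σ) v = -signedSum σ v := by
  simp [signedSum]

lemma UniformlyBounded.mul {a : I → ι → ℝ} (ha : UniformlyBounded a) (w : ι → ℝ) :
    UniformlyBounded fun h i => w i * a h i := by
  obtain ⟨C, hC⟩ := ha
  refine ⟨(∑ i, |w i|) * C, fun h i => ?_⟩
  rw [abs_mul]
  exact mul_le_mul (Finset.single_le_sum (f := fun i => |w i|) (fun i _ => abs_nonneg _)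
    (Finset.mem_univ i)) (hC h i) (abs_nonneg _) (Finset.sum_nonneg fun i _ => abs_nonneg _)

variable [DecidableEq ι]

lemma sum_signedSum_eq_zero (v : ι → ℝ) : ∑ σ : ι → ℤˣ, signedSum σ v = 0 := by
  have h := Equiv.sum_comp (Equiv.neg (ι → ℤˣ)) fun σ => signedSum σ v
  simp only [Equiv.neg_apply, signedSum_neg_left, Finset.sum_neg_distrib] at h
  linarith

/-- Any fixed member bounds every supremum from below, and its signed sums cancel under `σ ↦ -σ`. -/
lemma signAverage_nonneg [Nonempty I] {a : I → ι → ℝ} (ha : UniformlyBounded a) :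
    0 ≤ signAverage a := by
  refine mul_nonneg (by positivity) ?_
  obtain ⟨h⟩ := ‹Nonempty I›
  rw [← sum_signedSum_eq_zero (a h)]
  exact Finset.sum_le_sum fun σ _ => le_ciSup (bddAbove_signedSum ha σ) h

lemma signAverage_mul_left (a : I → ι → ℝ) {c : ℝ} (hc : 0 ≤ c) :
    signAverage (fun h i => c * a h i) = c * signAverage a := by
  simp only [signAverage, signedSum_mul_left, ← Real.mul_iSup_of_nonneg hc, ← Finset.mul_sum]
  ring

lemma signAverage_add_le [Nonempty I] {a b : I → ι → ℝ} (ha : UniformlyBounded a)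
    (hb : UniformlyBounded b) :
    signAverage (fun h i => a h i + b h i) ≤ signAverage a + signAverage b := by
  simp only [signAverage, signedSum_add, ← mul_add, ← Finset.sum_add_distrib]
  gcongr with σ
  exact ciSup_le fun h => add_le_add (le_ciSup (bddAbove_signedSum ha σ) h)
    (le_ciSup (bddAbove_signedSum hb σ) h)

/-- The Rademacher average only depends on the coordinates where the family does not vanish. -/
lemma signAverage_indicator (a : I → ι → ℝ) (T : Finset ι) :
    signAverage (fun h i => (if i ∈ T then 1 else 0) * a h i)
      = signAverage (fun h (i : {i // i ∈ T}) => a h i) := by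
  have key : ∀ (σ : ι → ℤˣ) (h : I), signedSum σ (fun i => (if i ∈ T then 1 else 0) * a h i)
      = signedSum (fun i : {i // i ∈ T} => σ i) (fun i => a h i) := by
    intro σ h
    simp only [signedSum]
    rw [Finset.sum_coe_sort T fun i => ((σ i : ℤ) : ℝ) * a h i]
    simp [Finset.sum_ite_mem]
  simp only [signAverage, key]
  -- Signs off `T` are irrelevant: each signing of `T` is counted `2 ^ (|ι| - |T|)` times, which is
  -- the ratio of the two normalisations.
  rw [← Equiv.sum_comp (Equiv.piEquivPiSubtypeProd (fun i => i ∈ T) fun _ => ℤˣ).symm,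
    Fintype.sum_prod_type]
  have key2 : ∀ (s : {i // i ∈ T} → ℤˣ) (t : {i // i ∉ T} → ℤˣ),
      (fun i : {i // i ∈ T} =>
        (Equiv.piEquivPiSubtypeProd (fun i => i ∈ T) fun _ => ℤˣ).symm (s, t) i) = s := by
    intro s t
    funext i
    simp [Equiv.piEquivPiSubtypeProd, i.2]
  simp only [key2, Finset.sum_const, Finset.card_univ, nsmul_eq_mul, ← Finset.mul_sum]
  rw [← mul_assoc]
  congr 1
  have hcard : Fintype.card ({i // i ∉ T} → ℤˣ) = 2 ^ (Fintype.card ι - T.card) := by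
    simp [Fintype.card_subtype_compl]
  rw [hcard, Fintype.card_coe]
  have hle : T.card ≤ Fintype.card ι := T.card_le_univ
  push_cast
  rw [div_mul_eq_mul_div, one_mul, div_eq_div_iff (by positivity) (by positivity), ← pow_add, one_mul]
  congr 1
  omega

end SignAverage

/-! ### Talagrand's contraction principle -/

/-- Symmetrised one-dimensional contraction. -/
lemma iSup_add_iSup_sub_le {I : Type*} [Nonempty I] {v a b : I → ℝ}
    (hp : BddAbove (Set.range fun h => v h + a h)) (hn : BddAbove (Set.range fun h => v h - a h))
    (hab : ∀ h k, |b h - b k| ≤ |a h - a k|) :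
    (⨆ h, (v h + b h)) + (⨆ h, (v h - b h)) ≤ (⨆ h, (v h + a h)) + ⨆ h, (v h - a h) := by
  -- The left side is at most `v h + v k + |a h - a k|`; the sign of `a h - a k` decides which of
  -- `h`, `k` goes into which supremum on the right.
  have key : ∀ h k, (v h + b h) + (v k - b k) ≤ (⨆ h, (v h + a h)) + ⨆ h, (v h - a h) := by
    intro h k
    have h1 := le_ciSup hp h
    have h2 := le_ciSup hn k
    have h3 := le_ciSup hp k
    have h4 := le_ciSup hn h
    have h5 := (le_abs_self _).trans (hab h k)
    rcases abs_cases (a h - a k) with h6 | h6 <;> linarith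
  have h1 : (⨆ h, (v h + b h))
      ≤ (⨆ h, (v h + a h)) + (⨆ h, (v h - a h)) - ⨆ h, (v h - b h) := by
    refine ciSup_le fun h => ?_
    have h2 : (⨆ h, (v h - b h))
      ≤ (⨆ h, (v h + a h)) + (⨆ h, (v h - a h)) - (v h + b h) :=
      ciSup_le fun k => by linarith [key h k]
    linarith
  linarith

lemma sum_sign_cons {n : ℕ} (F : (Fin (n + 1) → ℤˣ) → ℝ) :
    ∑ σ, F σ = ∑ τ : Fin n → ℤˣ, (F (Fin.cons 1 τ) + F (Fin.cons (-1) τ)) := by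
  rw [← Equiv.sum_comp (Fin.consEquiv fun _ => ℤˣ), Fintype.sum_prod_type_right]
  refine Finset.sum_congr rfl fun τ _ => ?_
  rw [show (Finset.univ : Finset ℤˣ) = {1, -1} from rfl]
  rw [Finset.sum_pair (by decide)]
  rfl

lemma signedSum_cons {n : ℕ} (s : ℤˣ) (τ : Fin n → ℤˣ) (v : Fin (n + 1) → ℝ) :
    signedSum (Fin.cons s τ : Fin (n + 1) → ℤˣ) v
      = ((s : ℤ) : ℝ) * v 0 + signedSum τ fun i => v i.succ := by
  simp [signedSum, Fin.sum_univ_succ]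

/-- The offset `u` makes the induction close: with `± b h 0` absorbed into it, the induction
hypothesis replaces the tail of `b` by that of `a`. The new tail then becomes the offset `v` of
`iSup_add_iSup_sub_le`, which replaces coordinate 0. -/
lemma sum_iSup_contraction {I : Type*} [Nonempty I] {n : ℕ} {a b : I → Fin n → ℝ}
    (ha : UniformlyBounded a) (hb : UniformlyBounded b)
    (hab : ∀ h k i, |b h i - b k i| ≤ |a h i - a k i|)
    {u : I → ℝ} (hu : ∃ C, ∀ h, |u h| ≤ C) :
    ∑ σ, ⨆ h, (u h + signedSum σ (b h)) ≤ ∑ σ, ⨆ h, (u h + signedSum σ (a h)) := by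
  induction n generalizing u with
  | zero => simp [signedSum]
  | succ n ih =>
    obtain ⟨C, hC⟩ := hu
    obtain ⟨A, hA⟩ := ha
    obtain ⟨A', hA'⟩ := hb
    have step : ∀ w : I → ℝ, (∃ C, ∀ h, |w h| ≤ C) →
        ∑ τ : Fin n → ℤˣ, ⨆ h, (w h + signedSum τ fun i => b h i.succ)
          ≤ ∑ τ : Fin n → ℤˣ, ⨆ h, (w h + signedSum τ fun i => a h i.succ) := fun w hw =>
      ih (a := fun h i => a h i.succ) (b := fun h i => b h i.succ)
        ⟨A, fun h i => hA h _⟩ ⟨A', fun h i => hA' h _⟩ (fun h k i => hab h k _) hw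
    have s1 := step (fun h => u h + b h 0)
      ⟨C + A', fun h => (abs_add_le _ _).trans (add_le_add (hC h) (hA' h 0))⟩
    have s2 := step (fun h => u h - b h 0)
      ⟨C + A', fun h => (abs_sub _ _).trans (add_le_add (hC h) (hA' h 0))⟩
    rw [sum_sign_cons, sum_sign_cons]
    simp only [signedSum_cons, Units.val_one, Units.val_neg, Int.cast_one, Int.cast_neg, one_mul,
      neg_mul]
    have bdd : ∀ τ : Fin n → ℤˣ, ∀ h, |u h + signedSum τ fun i => a h i.succ| ≤ C + n * A := by
      intro τ h
      refine (abs_add_le _ _).trans (add_le_add (hC h) ?_)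
      simpa using abs_signedSum_le_card_mul τ (v := fun i : Fin n => a h i.succ)
        (fun i => hA h i.succ)
    have s3 : ∀ τ : Fin n → ℤˣ, _ := fun τ =>
      iSup_add_iSup_sub_le (v := fun h => u h + signedSum τ fun i => a h i.succ)
        (a := fun h => a h 0) (b := fun h => b h 0)
        ⟨C + n * A + A, by
          rintro _ ⟨h, rfl⟩
          exact add_le_add ((le_abs_self _).trans (bdd τ h)) ((le_abs_self _).trans (hA h 0))⟩
        ⟨C + n * A + A, by
          rintro _ ⟨h, rfl⟩
          have := (le_abs_self _).trans (bdd τ h)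
          have := (neg_le_abs _).trans (hA h 0)
          simp only
          linarith⟩
        (fun h k => hab h k 0)
    have s4 := Finset.sum_le_sum fun τ (_ : τ ∈ Finset.univ) => s3 τ
    rw [Finset.sum_add_distrib, Finset.sum_add_distrib] at s4
    rw [Finset.sum_add_distrib, Finset.sum_add_distrib]
    simp only [sub_eq_add_neg, add_assoc, add_comm, add_left_comm] at s1 s2 s4 ⊢
    linarith

/-- Talagrand's contraction principle for Rademacher averages. -/
lemma signAverage_contraction {I : Type*} [Nonempty I] {n : ℕ} {a b : I → Fin n → ℝ}
    (ha : UniformlyBounded a) (hb : UniformlyBounded b)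
    (hab : ∀ h k i, |b h i - b k i| ≤ |a h i - a k i|) :
    signAverage b ≤ signAverage a := by
  have := sum_iSup_contraction ha hb hab (u := fun _ => 0) ⟨0, by simp⟩
  simp only [zero_add] at this
  exact mul_le_mul_of_nonneg_left this (by positivity)

/-! ### Sublinear functionals on nonnegative weight vectors -/

/-- Abel summation; the boundary term disappears later because `Q` vanishes at the end point. -/
lemma sum_range_sub_mul_sqrt (Q : ℕ → ℝ) (n : ℕ) :
    ∑ k ∈ Finset.range n, (Q k - Q (k + 1)) * √((k + 1 : ℕ) : ℝ)
      = ∑ k ∈ Finset.range n, Q k * (√((k + 1 : ℕ) : ℝ) - √(k : ℝ)) - Q n * √(n : ℝ) := by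
  induction n with
  | zero => simp
  | succ n ih =>
    rw [Finset.sum_range_succ, Finset.sum_range_succ, ih]
    ring

/-- The difference of roots is `1 / (√(k+1) + √k) ≤ 1 / √(k+1)`. -/
lemma sqrt_succ_sub_sqrt_sq_le (k : ℕ) :
    (√((k + 1 : ℕ) : ℝ) - √(k : ℝ)) ^ 2 ≤ ((k : ℝ) + 1)⁻¹ := by
  have h1 : √((k + 1 : ℕ) : ℝ) ^ 2 = k + 1 := by rw [Real.sq_sqrt (by positivity)]; push_cast; rfl
  have h2 : √(k : ℝ) ^ 2 = k := Real.sq_sqrt (by positivity)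
  have h3 : 0 ≤ √(k : ℝ) := Real.sqrt_nonneg _
  have h4 : √(k : ℝ) ≤ √((k + 1 : ℕ) : ℝ) := Real.sqrt_le_sqrt (by push_cast; linarith)
  set s := √((k + 1 : ℕ) : ℝ)
  set t := √(k : ℝ)
  rw [← h1, ← one_div, le_div_iff₀ (by rw [h1]; positivity), ← mul_pow]
  have h5 : (s - t) * s ≤ 1 := by nlinarith
  have h6 : 0 ≤ (s - t) * s := mul_nonneg (by linarith) (by linarith)
  exact pow_le_one₀ h6 h5

lemma sum_mul_sqrt_succ_sub_sqrt_le (Q : ℕ → ℝ) (n : ℕ) :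
    ∑ k ∈ Finset.range n, Q k * (√((k + 1 : ℕ) : ℝ) - √(k : ℝ))
      ≤ √(∑ k ∈ Finset.range n, Q k ^ 2) * (Real.log n + 1) := by
  have hlog : 0 ≤ Real.log n := Real.log_natCast_nonneg n
  refine (Real.sum_mul_le_sqrt_mul_sqrt _ _ _).trans ?_
  gcongr
  -- Cauchy–Schwarz and the harmonic sum give the factor `√(1 + log n)`, which is weakened to `1 +
  -- log n`.
  rw [Real.sqrt_le_left (by linarith)]
  have h1 : ∑ k ∈ Finset.range n, (√((k + 1 : ℕ) : ℝ) - √(k : ℝ)) ^ 2 ≤ 1 + Real.log n := by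
    refine (Finset.sum_le_sum fun k _ => sqrt_succ_sub_sqrt_sq_le k).trans ?_
    have := harmonic_le_one_add_log n
    simpa [harmonic] using this
  nlinarith

/-- A sublinear functional on weight vectors that is at most `K √|T|` on the indicator of every
nonempty `T` is at most `K (ln m + 1) ‖p‖₂` on every nonnegative `p`. -/
lemma sublinear_le_of_indicator_le {m : ℕ} (W : (Fin m → ℝ) → ℝ) (hW0 : W 0 = 0)
    (hadd : ∀ p q, W (p + q) ≤ W p + W q) (hsmul : ∀ (c : ℝ) p, 0 ≤ c → W (c • p) = c * W p)
    {K : ℝ} (hK : 0 ≤ K)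
    (hT : ∀ T : Finset (Fin m), T.Nonempty →
      W (fun i => if i ∈ T then 1 else 0) ≤ K * √(T.card : ℝ))
    (p : Fin m → ℝ) (hp : ∀ i, 0 ≤ p i) :
    W p ≤ K * (√(∑ i, p i ^ 2) * (Real.log m + 1)) := by
  set s := Tuple.sort fun i => -p i
  have hs : Antitone (p ∘ s) := fun i j hij => by
    have := Tuple.monotone_sort (fun i => -p i) hij
    simpa using this
  -- The decreasing rearrangement of `p`, padded by zeros: `Q m = 0` ends the telescoping sums and
  -- kills the Abel boundary term.
  set Q : ℕ → ℝ := fun k => if h : k < m then p (s ⟨k, h⟩) else 0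
  have hQ0 : ∀ k, m ≤ k → Q k = 0 := fun k hk => dif_neg (by omega)
  have hQi : ∀ i : Fin m, Q i = p (s i) := fun i => dif_pos i.2
  have hQ : ∀ k, Q (k + 1) ≤ Q k := by
    intro k
    by_cases h : k + 1 < m
    · rw [hQi ⟨k + 1, h⟩, hQi ⟨k, by omega⟩]
      exact hs (by simp)
    · rw [hQ0 (k + 1) (by omega)]
      by_cases h' : k < m
      · rw [hQi ⟨k, h'⟩]; exact hp _
      · rw [hQ0 k (by omega)]
  set T : ℕ → Finset (Fin m) := fun k => Finset.univ.filter fun i => (s.symm i : ℕ) < k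
  have hTcard : ∀ k, k ≤ m → (T k).card = k := by
    intro k hk
    have : T k = (Finset.univ.filter fun j : Fin m => (j : ℕ) < k).map s.toEmbedding := by
      ext i
      simp [T]
    rw [this, Finset.card_map, Fin.card_filter_val_lt]
    omega
  -- Layer-cake decomposition: `T (k + 1)` holds the `k + 1` largest coordinates, and the coordinate
  -- of rank `j` collects the increments from `j` on, which telescope to `Q j`.
  have hdec : p = ∑ k ∈ Finset.range m,
      (Q k - Q (k + 1)) • (fun i => if i ∈ T (k + 1) then (1 : ℝ) else 0) := by
    ext i
    obtain ⟨j, rfl⟩ := s.surjective i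
    simp only [Finset.sum_apply, Pi.smul_apply, smul_eq_mul, T, Finset.mem_filter,
      Finset.mem_univ, true_and, Equiv.symm_apply_apply, mul_ite, mul_one, mul_zero]
    rw [← Finset.sum_filter]
    have : (Finset.range m).filter (fun k => (j : ℕ) < k + 1) = Finset.Ico (j : ℕ) m := by
      ext k; simp; omega
    rw [this, Finset.sum_Ico_eq_sum_range]
    have h2 := Finset.sum_range_sub' (fun k => Q (j + k)) (m - j)
    simp only [add_assoc] at h2 ⊢
    rw [h2, add_zero, hQi, show (j : ℕ) + (m - j) = m by omega, hQ0 m le_rfl, sub_zero]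
  have hsum : ∀ (R : Finset ℕ) (v : ℕ → Fin m → ℝ), W (∑ k ∈ R, v k) ≤ ∑ k ∈ R, W (v k) := by
    intro R v
    induction R using Finset.induction_on with
    | empty => simp [hW0]
    | insert k R hk ih =>
      rw [Finset.sum_insert hk, Finset.sum_insert hk]
      exact (hadd _ _).trans (add_le_add le_rfl ih)
  have hsq : ∑ k ∈ Finset.range m, Q k ^ 2 = ∑ i, p i ^ 2 := by
    rw [← Fin.sum_univ_eq_sum_range (fun k => Q k ^ 2), ← Equiv.sum_comp s fun i => p i ^ 2]
    simp [hQi]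
  calc W p = W (∑ k ∈ Finset.range m,
      (Q k - Q (k + 1)) • (fun i => if i ∈ T (k + 1) then (1 : ℝ) else 0)) := by rw [← hdec]
    _ ≤ ∑ k ∈ Finset.range m, (Q k - Q (k + 1)) * (K * √((k + 1 : ℕ) : ℝ)) := by
      refine (hsum _ _).trans (Finset.sum_le_sum fun k hk => ?_)
      have hk' : k + 1 ≤ m := Finset.mem_range.1 hk
      rw [hsmul _ _ (sub_nonneg.2 (hQ k))]
      refine mul_le_mul_of_nonneg_left ?_ (sub_nonneg.2 (hQ k))
      have := hT (T (k + 1)) (Finset.card_pos.1 (by rw [hTcard _ hk']; omega))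
      rwa [hTcard _ hk'] at this
    _ = K * ∑ k ∈ Finset.range m, (Q k - Q (k + 1)) * √((k + 1 : ℕ) : ℝ) := by
      rw [Finset.mul_sum]
      exact Finset.sum_congr rfl fun k _ => by ring
    _ ≤ _ := by
      rw [sum_range_sub_mul_sqrt, hQ0 m le_rfl, zero_mul, sub_zero, ← hsq]
      exact mul_le_mul_of_nonneg_left (sum_mul_sqrt_succ_sub_sqrt_le Q m) hK

/-! ### McDiarmid's inequality -/

lemma integrable_of_abs_le {Ω : Type*} [MeasurableSpace Ω] {μ : Measure Ω} [IsFiniteMeasure μ]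
    {F : Ω → ℝ} (hF : Measurable F) {M : ℝ} (hM : ∀ x, |F x| ≤ M) : Integrable F μ :=
  Integrable.of_bound hF.aestronglyMeasurable M (Filter.Eventually.of_forall hM)

lemma integral_pi_fin_succ {Z : Type*} [MeasurableSpace Z] (μ : Measure Z)
    [IsProbabilityMeasure μ] {n : ℕ} {F : (Fin (n + 1) → Z) → ℝ}
    (hF : Integrable F (Measure.pi fun _ => μ)) :
    ∫ z, F z ∂(Measure.pi fun _ => μ)
      = ∫ x, ∫ t, F (Fin.cons x t) ∂(Measure.pi fun _ : Fin n => μ) ∂μ := by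
  have h := (measurePreserving_piFinSuccAbove (fun _ : Fin (n + 1) => μ) 0).symm
  rw [← h.integral_comp' F, integral_prod]
  · simp [MeasurableEquiv.piFinSuccAbove, Fin.insertNthEquiv]
  · exact (h.integrable_comp_emb (MeasurableEquiv.measurableEmbedding _)).2 hF

lemma measurable_fin_cons {Z : Type*} [MeasurableSpace Z] {n : ℕ} :
    Measurable fun q : Z × (Fin n → Z) => (Fin.cons q.1 q.2 : Fin (n + 1) → Z) := by
  refine measurable_pi_iff.2 fun i => ?_
  refine Fin.cases ?_ (fun i => ?_) i
  · simpa using measurable_fst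
  · simp only [Fin.cons_succ]
    exact (measurable_pi_apply i).comp measurable_snd

/-- Hoeffding's lemma for a bounded function of oscillation at most `c`. -/
lemma integral_exp_le_of_oscillation_le {Z : Type*} [MeasurableSpace Z] {μ : Measure Z}
    [IsProbabilityMeasure μ] {g : Z → ℝ} (hg : Measurable g) {c : ℝ} (hc : ∀ x y, g x - g y ≤ c)
    (l : ℝ) :
    ∫ x, Real.exp (l * (g x - ∫ y, g y ∂μ)) ∂μ ≤ Real.exp (l ^ 2 * c ^ 2 / 8) := by
  obtain ⟨x₀⟩ : Nonempty Z := μ.nonempty_of_neZero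
  have hbdd : BddBelow (Set.range g) := ⟨g x₀ - c, by
    rintro _ ⟨x, rfl⟩
    linarith [hc x₀ x]⟩
  have : Nonempty Z := ⟨x₀⟩
  -- Oscillation at most `c` puts `g` in an interval of length `c` starting at its infimum, the form
  -- needed for Hoeffding's lemma.
  have hmem : ∀ x, g x ∈ Set.Icc (⨅ y, g y) ((⨅ y, g y) + c) := fun x =>
    ⟨ciInf_le hbdd x, by
      have : g x - c ≤ ⨅ y, g y := le_ciInf fun y => by linarith [hc x y]
      linarith⟩
  have h := (hasSubgaussianMGF_of_mem_Icc hg.aemeasurable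
    (Filter.Eventually.of_forall hmem : ∀ᵐ x ∂μ, _)).mgf_le l
  refine (le_of_eq rfl).trans (h.trans (le_of_eq ?_))
  congr 1
  simp only [add_sub_cancel_left, NNReal.coe_pow, NNReal.coe_div, coe_nnnorm, Real.norm_eq_abs,
    div_pow, sq_abs, NNReal.coe_ofNat]
  ring

/-- The exponential moment bound behind McDiarmid's inequality. -/
lemma integral_exp_le_of_bounded_differences {Z : Type*} [MeasurableSpace Z] (μ : Measure Z)
    [IsProbabilityMeasure μ] {n : ℕ} {F : (Fin n → Z) → ℝ} (hF : Measurable F) {M c : ℝ}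
    (hM : ∀ z, |F z| ≤ M) (hc : ∀ z i x, F z - F (Function.update z i x) ≤ c) (l : ℝ) :
    ∫ z, Real.exp (l * (F z - ∫ w, F w ∂(Measure.pi fun _ => μ))) ∂(Measure.pi fun _ => μ)
      ≤ Real.exp (n * (l ^ 2 * c ^ 2 / 8)) := by
  induction n with
  | zero =>
    have hconst : F = fun _ => F Fin.elim0 := funext fun z => congrArg F (Subsingleton.elim _ _)
    rw [hconst]
    simp
  | succ n ih =>
    set P : Measure (Fin n → Z) := Measure.pi fun _ => μ
    set a := ∫ w, F w ∂(Measure.pi fun _ : Fin (n + 1) => μ)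
    have hFc : Measurable fun q : Z × (Fin n → Z) => F (Fin.cons q.1 q.2) :=
      hF.comp measurable_fin_cons
    have hFx : ∀ x, Measurable fun t : Fin n → Z => F (Fin.cons x t) := fun x =>
      hFc.comp (measurable_const.prodMk measurable_id)
    -- `g` is the conditional mean given the first coordinate. In `F - a = (F - g) + (g - a)` the
    -- first term is handled by induction with that coordinate frozen, the second by Hoeffding,
    -- since averaging keeps the oscillation at most `c`.
    set g : Z → ℝ := fun x => ∫ t, F (Fin.cons x t) ∂P
    have hg : Measurable g := hFc.stronglyMeasurable.integral_prod_right.measurable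
    have hint : ∀ x, Integrable (fun t => F (Fin.cons x t)) P := fun x =>
      integrable_of_abs_le (hFx x) fun t => hM _
    have hgc : ∀ x y, g x - g y ≤ c := by
      intro x y
      simp only [g]
      rw [← integral_sub (hint x) (hint y)]
      have : ∫ t, (F (Fin.cons x t) - F (Fin.cons y t)) ∂P ≤ ∫ _, c ∂P := by
        refine integral_mono ((hint x).sub (hint y)) (integrable_const c) fun t => ?_
        have := hc (Fin.cons x t) 0 y
        rwa [Fin.update_cons_zero] at this
      simpa using this
    have hgM : ∀ x, |g x| ≤ M := fun x => by
      have := norm_integral_le_of_norm_le_const (μ := P) (f := fun t => F (Fin.cons x t)) (C := M)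
        (Filter.Eventually.of_forall fun t => hM _)
      simpa using this
    have ha : a = ∫ x, g x ∂μ := integral_pi_fin_succ μ (integrable_of_abs_le hF hM)
    have haM : |a| ≤ M := by
      have := norm_integral_le_of_norm_le_const (μ := Measure.pi fun _ : Fin (n + 1) => μ)
        (f := F) (C := M) (Filter.Eventually.of_forall hM)
      simpa using this
    have hexpbdd : ∀ s b : ℝ, |s| ≤ M → |b| ≤ M →
        |Real.exp (l * (s - b))| ≤ Real.exp (|l| * (2 * M)) := by
      intro s b hs hb
      rw [abs_of_pos (Real.exp_pos _), Real.exp_le_exp]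
      refine (le_abs_self _).trans ?_
      rw [abs_mul]
      gcongr
      exact (abs_sub _ _).trans (by linarith)
    have hinner : ∀ x, ∫ t, Real.exp (l * (F (Fin.cons x t) - a)) ∂P
        ≤ Real.exp (l * (g x - a)) * Real.exp (n * (l ^ 2 * c ^ 2 / 8)) := by
      intro x
      have h1 := ih (F := fun t => F (Fin.cons x t)) (hFx x) (fun t => hM _) (fun t i y => by
        have := hc (Fin.cons x t) i.succ y
        rwa [← Fin.cons_update] at this)
      have h2 : ∀ t, Real.exp (l * (F (Fin.cons x t) - a))
          = Real.exp (l * (g x - a)) * Real.exp (l * (F (Fin.cons x t) - g x)) := fun t => by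
        rw [← Real.exp_add]; congr 1; ring
      simp only [h2]
      rw [integral_const_mul]
      exact mul_le_mul_of_nonneg_left h1 (Real.exp_pos _).le
    rw [integral_pi_fin_succ (F := fun z => Real.exp (l * (F z - a))) μ (integrable_of_abs_le
      (Real.measurable_exp.comp ((hF.sub_const a).const_mul l)) fun z => hexpbdd _ _ (hM z) haM)]
    calc ∫ x, ∫ t, Real.exp (l * (F (Fin.cons x t) - a)) ∂P ∂μ
        ≤ ∫ x, Real.exp (l * (g x - a)) * Real.exp (n * (l ^ 2 * c ^ 2 / 8)) ∂μ := by
          refine integral_mono ?_ ?_ hinner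
          · have hm : Measurable fun q : Z × (Fin n → Z) =>
                Real.exp (l * (F (Fin.cons q.1 q.2) - a)) :=
              Real.measurable_exp.comp ((hFc.sub_const a).const_mul l)
            exact (integrable_of_abs_le (μ := μ.prod P) hm
              fun q => hexpbdd _ _ (hM _) haM).integral_prod_left
          · exact (integrable_of_abs_le (Real.measurable_exp.comp ((hg.sub_const a).const_mul l))
              fun x => hexpbdd _ _ (hgM x) haM).mul_const _
      _ ≤ Real.exp (l ^ 2 * c ^ 2 / 8) * Real.exp (n * (l ^ 2 * c ^ 2 / 8)) := by
          rw [integral_mul_const, ha]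
          exact mul_le_mul_of_nonneg_right (integral_exp_le_of_oscillation_le hg hgc l)
            (Real.exp_pos _).le
      _ = _ := by
          rw [← Real.exp_add]
          congr 1
          push_cast
          ring

/-- McDiarmid's inequality: a function of `n` independent variables with mean at most zero whose
one-coordinate differences are at most `c` is at most `c n √(ln(1/δ) / (2 n))` off an event of
probability at most `δ`. -/
lemma one_sub_le_measureReal_of_bounded_differences {Z : Type*} [MeasurableSpace Z]
    (μ : Measure Z) [IsProbabilityMeasure μ] {n : ℕ} (hn : 1 ≤ n) {F : (Fin n → Z) → ℝ}
    (hF : Measurable F) {M c : ℝ} (hc0 : 0 < c) (hM : ∀ z, |F z| ≤ M)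
    (hc : ∀ z i x, F z - F (Function.update z i x) ≤ c)
    (hmean : ∫ z, F z ∂(Measure.pi fun _ => μ) ≤ 0) {δ : ℝ} (hδ0 : 0 < δ) (hδ1 : δ < 1) :
    1 - δ ≤ (Measure.pi fun _ : Fin n => μ).real
      {z | F z ≤ c * n * √(Real.log (1 / δ) / (2 * n))} := by
  set P : Measure (Fin n → Z) := Measure.pi fun _ => μ
  set a := ∫ z, F z ∂P
  set L := Real.log (1 / δ)
  have hL : 0 < L := Real.log_pos (by rw [lt_div_iff₀ hδ0]; linarith)
  have hn0 : (0 : ℝ) < n := by exact_mod_cast hn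
  set r := √(L / (2 * n))
  have hr : r ^ 2 = L / (2 * n) := Real.sq_sqrt (by positivity)
  have hr0 : 0 < r := Real.sqrt_pos.2 (by positivity)
  set t := c * n * r
  -- The minimiser of the Chernoff exponent `-l t + n l² c² / 8`; the minimum is `-2 n r² = -L`.
  set l := 4 * r / c
  have hl : 0 ≤ l := by positivity
  have hmgf := integral_exp_le_of_bounded_differences μ hF hM hc l
  have haM : |a| ≤ M := by
    have := norm_integral_le_of_norm_le_const (μ := P)
      (f := F) (C := M) (Filter.Eventually.of_forall hM)
    simpa using this
  have hint : Integrable (fun z => Real.exp (l * (F z - a))) P := by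
    refine integrable_of_abs_le (M := Real.exp (l * (2 * M)))
      (Real.measurable_exp.comp ((hF.sub_const a).const_mul l)) fun z => ?_
    rw [abs_of_pos (Real.exp_pos _), Real.exp_le_exp]
    refine mul_le_mul_of_nonneg_left ?_ hl
    have := (le_abs_self _).trans (hM z)
    have := (neg_le_abs _).trans haM
    linarith
  have htail := measure_ge_le_exp_mul_mgf (μ := P) (X := fun z => F z - a) t hl hint
  have hδ : P.real {z | t ≤ F z - a} ≤ δ := by
    refine htail.trans ((mul_le_mul_of_nonneg_left hmgf (Real.exp_pos _).le).trans (le_of_eq ?_))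
    rw [← Real.exp_add]
    have : -l * t + n * (l ^ 2 * c ^ 2 / 8) = -L := by
      have h1 : -l * t + n * (l ^ 2 * c ^ 2 / 8) = -(2 * n) * r ^ 2 := by
        simp only [l, t]
        field_simp
        ring
      rw [h1, hr]
      field_simp
    rw [this, Real.exp_neg, Real.exp_log (by positivity)]
    simp
  have hmeas : MeasurableSet {z | F z ≤ t} := measurableSet_le hF measurable_const
  have hcompl : P.real {z | F z ≤ t}ᶜ ≤ δ := by
    -- As the mean `a` is at most zero, `F z > t` forces `F z - a ≥ t`.
    refine (measureReal_mono fun z hz => ?_).trans hδ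
    simp only [Set.mem_compl_iff, Set.mem_ofPred_eq, not_le] at hz ⊢
    linarith
  rw [probReal_compl_eq_one_sub hmeas] at hcompl
  linarith

/-! ### Uniform deviations and symmetrisation -/

section UniformDeviation

variable {I Z : Type*} {L : I → Z → ℝ} {n : ℕ} {C : ℝ}

/-- The empirical Rademacher average of a class of losses. -/
noncomputable def empiricalSignAverage (L : I → Z → ℝ) {n : ℕ} (z : Fin n → Z) : ℝ :=
  signAverage fun g i => (1 / (n : ℝ)) * L g (z i)

lemma abs_ciSup_le_of_abs_le [Nonempty I] {f : I → ℝ} {K : ℝ} (h : ∀ g, |f g| ≤ K) :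
    |⨆ g, f g| ≤ K := by
  obtain ⟨g⟩ := ‹Nonempty I›
  have : Nonempty I := ⟨g⟩
  have hb : BddAbove (Set.range f) := ⟨K, by rintro _ ⟨g, rfl⟩; exact (abs_le.1 (h g)).2⟩
  exact abs_le.2 ⟨(abs_le.1 (h g)).1.trans (le_ciSup hb g), ciSup_le fun g => (abs_le.1 (h g)).2⟩

lemma bddAbove_range_of_abs_le {f : I → ℝ} {K : ℝ} (h : ∀ g, |f g| ≤ K) :
    BddAbove (Set.range f) :=
  ⟨K, by rintro _ ⟨g, rfl⟩; exact (abs_le.1 (h g)).2⟩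

lemma abs_div_nat_mul_le {x : ℝ} (hx : x ∈ Set.Icc 0 C) : |(1 / (n : ℝ)) * x| ≤ 1 / (n : ℝ) * C := by
  rw [abs_mul, abs_of_nonneg (by positivity : (0 : ℝ) ≤ 1 / n), abs_of_nonneg hx.1]
  exact mul_le_mul_of_nonneg_left hx.2 (by positivity)

lemma abs_signedSum_div_nat_le (hn : 1 ≤ n) (σ : Fin n → ℤˣ) {v : Fin n → ℝ}
    (hv : ∀ i, v i ∈ Set.Icc 0 C) : |signedSum σ fun i => (1 / (n : ℝ)) * v i| ≤ C := by
  have hn0 : (0 : ℝ) < n := by exact_mod_cast hn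
  refine (abs_signedSum_le_card_mul σ fun i => abs_div_nat_mul_le (hv i)).trans (le_of_eq ?_)
  rw [Fintype.card_fin]
  field_simp

lemma abs_empiricalSignAverage_le [Nonempty I] (hn : 1 ≤ n) (hL : ∀ g x, L g x ∈ Set.Icc 0 C)
    (z : Fin n → Z) : |empiricalSignAverage L z| ≤ C := by
  rw [empiricalSignAverage, signAverage, abs_mul,
    abs_of_nonneg (by positivity : (0 : ℝ) ≤ 1 / 2 ^ Fintype.card (Fin n)), one_div,
    inv_mul_le_iff₀ (by positivity)]
  refine (Finset.abs_sum_le_sum_abs _ _).trans ?_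
  refine (Finset.sum_le_sum fun σ _ => abs_ciSup_le_of_abs_le fun g =>
    abs_signedSum_div_nat_le hn σ fun i => hL g (z i)).trans (le_of_eq ?_)
  simp

lemma empirical_mean_mem_Icc (hn : 1 ≤ n) {v : Fin n → ℝ} (hv : ∀ i, v i ∈ Set.Icc 0 C) :
    (1 / (n : ℝ)) * ∑ i, v i ∈ Set.Icc 0 C := by
  have hn0 : (0 : ℝ) < n := by exact_mod_cast hn
  refine ⟨mul_nonneg (by positivity) (Finset.sum_nonneg fun i _ => (hv i).1), ?_⟩
  have : ∑ i, v i ≤ ∑ _i : Fin n, C := Finset.sum_le_sum fun i _ => (hv i).2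
  simp only [Finset.sum_const, Finset.card_univ, Fintype.card_fin, nsmul_eq_mul] at this
  rw [one_div, inv_mul_le_iff₀ hn0]
  exact this

lemma sum_sub_sum_update (φ : Fin n → Z → ℝ) (z : Fin n → Z) (i : Fin n) (x : Z) :
    ∑ j, φ j (z j) - ∑ j, φ j (Function.update z i x j) = φ i (z i) - φ i x := by
  rw [← Finset.sum_sub_distrib, Finset.sum_eq_single i]
  · simp
  · intro j _ hj
    simp [Function.update_of_ne hj]
  · simp

lemma ciSup_le_ciSup_add [Nonempty I] {f h : I → ℝ} {K : ℝ} (hb : BddAbove (Set.range h))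
    (hfh : ∀ g, f g ≤ h g + K) : ⨆ g, f g ≤ (⨆ g, h g) + K :=
  ciSup_le fun g => (hfh g).trans (add_le_add (le_ciSup hb g) le_rfl)

/-- Only one term of each signed sum changes; since losses lie in `[0, C]`, two of them differ by at
most `C`, not `2C`. -/
lemma empiricalSignAverage_update_sub_le [Nonempty I] (hn : 1 ≤ n)
    (hL : ∀ g x, L g x ∈ Set.Icc 0 C) (z : Fin n → Z) (i : Fin n) (x : Z) :
    empiricalSignAverage L (Function.update z i x) - empiricalSignAverage L z
      ≤ 1 / (n : ℝ) * C := by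
  rw [empiricalSignAverage, empiricalSignAverage, signAverage, signAverage, ← mul_sub,
    ← Finset.sum_sub_distrib, one_div, inv_mul_le_iff₀ (by positivity)]
  refine (Finset.sum_le_sum (g := fun _ => 1 / (n : ℝ) * C) fun σ _ => ?_).trans
    (le_of_eq (by simp))
  rw [sub_le_iff_le_add']
  refine ciSup_le_ciSup_add (bddAbove_range_of_abs_le fun g =>
    abs_signedSum_div_nat_le hn σ fun j => hL g (z j)) fun g => ?_
  have h1 := sum_sub_sum_update (fun j y => ((σ j : ℤ) : ℝ) * (1 / (n : ℝ) * L g y)) z i x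
  have h2 : |L g x - L g (z i)| ≤ C := abs_le.2
    ⟨by linarith [(hL g x).1, (hL g (z i)).2], by linarith [(hL g x).2, (hL g (z i)).1]⟩
  have h3 : ((σ i : ℤ) : ℝ) * (1 / (n : ℝ) * (L g x - L g (z i))) ≤ 1 / (n : ℝ) * C := by
    refine (le_abs_self _).trans ?_
    rw [abs_mul, abs_units_cast, one_mul, abs_mul, abs_of_nonneg (by positivity : (0 : ℝ) ≤ 1 / n)]
    exact mul_le_mul_of_nonneg_left h2 (by positivity)
  simp only [signedSum]
  rw [mul_sub, mul_sub] at h3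
  linarith

lemma abs_signedSum_sub_le (hn : 1 ≤ n) (hL : ∀ g x, L g x ∈ Set.Icc 0 C) (σ : Fin n → ℤˣ)
    (w : Fin n → Z × Z) (g : I) :
    |signedSum σ (fun i => (1 / (n : ℝ)) * (L g (w i).2 - L g (w i).1))| ≤ C := by
  have hn0 : (0 : ℝ) < n := by exact_mod_cast hn
  refine (abs_signedSum_le_card_mul σ (C := 1 / (n : ℝ) * C) fun i => ?_).trans (le_of_eq ?_)
  · rw [abs_mul, abs_of_nonneg (by positivity : (0 : ℝ) ≤ 1 / n)]
    have h1 := hL g (w i).1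
    have h2 := hL g (w i).2
    exact mul_le_mul_of_nonneg_left
      (abs_le.2 ⟨by linarith [h1.2, h2.1], by linarith [h1.1, h2.2]⟩) (by positivity)
  · rw [Fintype.card_fin]
    field_simp

variable [MeasurableSpace Z]

/-- The largest excess of the mean over the empirical mean. -/
noncomputable def supDeviation (L : I → Z → ℝ) (μ : Measure Z) {n : ℕ} (z : Fin n → Z) : ℝ :=
  ⨆ g, (∫ x, L g x ∂μ - (1 / (n : ℝ)) * ∑ i, L g (z i))

/-- Suprema of linear combinations of the losses at finitely many points and of the mean loss are
measurable. -/
def HasMeasurableSuprema (L : I → Z → ℝ) (μ : Measure Z) : Prop :=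
  ∀ (k : ℕ) (a₀ : ℝ) (a : Fin k → ℝ),
    Measurable fun z : Fin k → Z => ⨆ g, (a₀ * ∫ x, L g x ∂μ + ∑ i, a i * L g (z i))

variable {μ : Measure Z}

lemma HasMeasurableSuprema.measurable_supDeviation (h : HasMeasurableSuprema L μ) :
    Measurable (supDeviation L μ : (Fin n → Z) → ℝ) := by
  have := h n 1 fun _ => -(1 / (n : ℝ))
  change Measurable fun z => supDeviation L μ z
  simpa only [supDeviation, one_mul, neg_mul, ← Finset.mul_sum, Finset.sum_neg_distrib, ← sub_eq_add_neg]
    using this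

lemma HasMeasurableSuprema.measurable_iSup_signedSum (h : HasMeasurableSuprema L μ)
    (σ : Fin n → ℤˣ) :
    Measurable fun z : Fin n → Z => ⨆ g, signedSum σ fun i => (1 / (n : ℝ)) * L g (z i) := by
  have := h n 0 fun i => ((σ i : ℤ) : ℝ) * (1 / (n : ℝ))
  simpa only [zero_mul, zero_add, mul_assoc, signedSum] using this

lemma HasMeasurableSuprema.measurable_empiricalSignAverage (h : HasMeasurableSuprema L μ) :
    Measurable (empiricalSignAverage L : (Fin n → Z) → ℝ) :=
  (Finset.measurable_sum _ fun σ _ => h.measurable_iSup_signedSum σ).const_mul _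

lemma measurable_fin_append {k : ℕ} {Ω : Type*} [MeasurableSpace Ω] {u : Ω → Fin n → Z}
    {v : Ω → Fin k → Z} (hu : Measurable u) (hv : Measurable v) :
    Measurable fun w => Fin.append (u w) (v w) := by
  refine measurable_pi_iff.2 fun i => ?_
  refine Fin.addCases (fun j => ?_) (fun j => ?_) i
  · simpa only [Fin.append_left] using measurable_pi_iff.1 hu j
  · simpa only [Fin.append_right] using measurable_pi_iff.1 hv j

lemma HasMeasurableSuprema.measurable_iSup_signedSum_sub (h : HasMeasurableSuprema L μ)
    (σ : Fin n → ℤˣ) :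
    Measurable fun w : Fin n → Z × Z =>
      ⨆ g, signedSum σ fun i => (1 / (n : ℝ)) * (L g (w i).2 - L g (w i).1) := by
  -- A supremum over differences on `n` pairs is one over a linear combination at `2n` points, with
  -- opposite coefficients on the two halves.
  have h1 := h (n + n) 0 (Fin.append (fun i => ((σ i : ℤ) : ℝ) * (1 / (n : ℝ)))
    fun i => -(((σ i : ℤ) : ℝ) * (1 / (n : ℝ))))
  have h2 := h1.comp (measurable_fin_append (Ω := Fin n → Z × Z)
    (u := fun w i => (w i).2) (v := fun w i => (w i).1)
    (measurable_pi_iff.2 fun i => (measurable_pi_apply i).snd)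
    (measurable_pi_iff.2 fun i => (measurable_pi_apply i).fst))
  refine (congrArg Measurable (funext fun w => iSup_congr fun g => ?_)).mp h2
  simp only [signedSum, zero_mul, zero_add, Fin.sum_univ_add,
    Fin.append_left, Fin.append_right, ← Finset.sum_add_distrib]
  exact Finset.sum_congr rfl fun i _ => by ring

lemma integral_mem_Icc [IsProbabilityMeasure μ] {l : Z → ℝ} (hl : Measurable l)
    (hC : ∀ x, l x ∈ Set.Icc 0 C) : ∫ x, l x ∂μ ∈ Set.Icc 0 C := by
  refine ⟨integral_nonneg fun x => (hC x).1, ?_⟩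
  have : ∫ x, l x ∂μ ≤ ∫ _, C ∂μ := integral_mono
    (integrable_of_abs_le hl fun x => abs_le.2 ⟨by linarith [(hC x).1, (hC x).2], (hC x).2⟩)
    (integrable_const C) fun x => (hC x).2
  simpa using this

lemma abs_mean_sub_empirical_mean_le [IsProbabilityMeasure μ] (hn : 1 ≤ n)
    (hLm : ∀ g, Measurable (L g)) (hL : ∀ g x, L g x ∈ Set.Icc 0 C) (z : Fin n → Z) (g : I) :
    |∫ x, L g x ∂μ - (1 / (n : ℝ)) * ∑ i, L g (z i)| ≤ C := by
  have h1 := integral_mem_Icc (μ := μ) (hLm g) (hL g)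
  have h2 := empirical_mean_mem_Icc hn fun i => hL g (z i)
  exact abs_le.2 ⟨by linarith [h1.1, h2.2], by linarith [h1.2, h2.1]⟩

lemma supDeviation_sub_update_le [Nonempty I] [IsProbabilityMeasure μ] (hn : 1 ≤ n)
    (hLm : ∀ g, Measurable (L g)) (hL : ∀ g x, L g x ∈ Set.Icc 0 C)
    (z : Fin n → Z) (i : Fin n) (x : Z) :
    supDeviation L μ z - supDeviation L μ (Function.update z i x) ≤ 1 / (n : ℝ) * C := by
  rw [sub_le_iff_le_add']
  refine ciSup_le_ciSup_add
    (bddAbove_range_of_abs_le (abs_mean_sub_empirical_mean_le hn hLm hL _)) fun g => ?_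
  have h1 := sum_sub_sum_update (fun _ => L g) z i x
  have h2 : L g x - L g (z i) ≤ C := by linarith [(hL g x).2, (hL g (z i)).1]
  have h3 := mul_le_mul_of_nonneg_left h2 (by positivity : (0 : ℝ) ≤ 1 / n)
  rw [show L g x - L g (z i) = ∑ j, L g (Function.update z i x j) - ∑ j, L g (z j) by linarith,
    mul_sub] at h3
  linarith

/-- Swapping the two entries of the `i`-th pair preserves the product measure and flips the sign of
the `i`-th difference, so the integral does not depend on `σ`. -/
lemma integral_iSup_signedSum_sub_eq [IsProbabilityMeasure μ] (h : HasMeasurableSuprema L μ)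
    (σ : Fin n → ℤˣ) :
    ∫ w : Fin n → Z × Z, ⨆ g, signedSum σ (fun i => (1 / (n : ℝ)) * (L g (w i).2 - L g (w i).1))
        ∂(Measure.pi fun _ => μ.prod μ)
      = ∫ w : Fin n → Z × Z, ⨆ g, signedSum 1 (fun i => (1 / (n : ℝ)) * (L g (w i).2 - L g (w i).1))
        ∂(Measure.pi fun _ => μ.prod μ) := by
  have hmp : MeasurePreserving
      (fun (w : Fin n → Z × Z) i => (if σ i = 1 then id else Prod.swap : Z × Z → Z × Z) (w i))
      (Measure.pi fun _ => μ.prod μ) (Measure.pi fun _ => μ.prod μ) := by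
    refine measurePreserving_pi (fun _ => μ.prod μ) (fun _ => μ.prod μ) fun i => ?_
    split_ifs
    · exact MeasurePreserving.id _
    · exact Measure.measurePreserving_swap
  conv_rhs => rw [← hmp.map_eq]
  rw [integral_map hmp.measurable.aemeasurable
    (h.measurable_iSup_signedSum_sub 1).aestronglyMeasurable]
  refine integral_congr_ae (Filter.Eventually.of_forall fun w => iSup_congr fun g =>
    Finset.sum_congr rfl fun i _ => ?_)
  rcases Int.units_eq_one_or (σ i) with hi | hi
  · simp [hi]
  · have : (-1 : ℤˣ) ≠ 1 := by decide
    simp only [hi, this, if_false, Prod.fst_swap, Prod.snd_swap, Pi.one_apply]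
    push_cast
    ring

/-- The mean loss is the expected empirical mean on an independent ghost sample (second entries of
the pairs), and a supremum of integrals is at most the integral of the supremum. -/
lemma integral_supDeviation_le_ghost [Nonempty I] [IsProbabilityMeasure μ] (hn : 1 ≤ n)
    (h : HasMeasurableSuprema L μ) (hLm : ∀ g, Measurable (L g))
    (hL : ∀ g x, L g x ∈ Set.Icc 0 C) :
    ∫ z : Fin n → Z, supDeviation L μ z ∂(Measure.pi fun _ => μ)
      ≤ ∫ w : Fin n → Z × Z, ⨆ g, signedSum 1
          (fun i => (1 / (n : ℝ)) * (L g (w i).2 - L g (w i).1))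
        ∂(Measure.pi fun _ => μ.prod μ) := by
  have hn0 : (0 : ℝ) < n := by exact_mod_cast hn
  set P : Measure (Fin n → Z) := Measure.pi fun _ => μ
  set H : (Fin n → Z × Z) → ℝ := fun w => ⨆ g, signedSum 1
    (fun i => (1 / (n : ℝ)) * (L g (w i).2 - L g (w i).1))
  have hmp := (measurePreserving_arrowProdEquivProdArrow Z Z (Fin n) (fun _ => μ)
    (fun _ => μ)).symm
  set K : (Fin n → Z) × (Fin n → Z) → ℝ := fun q => H fun i => (q.1 i, q.2 i)
  have hHm : Measurable H := h.measurable_iSup_signedSum_sub 1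
  have hKm : Measurable K := hHm.comp (measurable_pi_iff.2 fun i =>
    ((measurable_pi_apply i).comp measurable_fst).prodMk
      ((measurable_pi_apply i).comp measurable_snd))
  have hHC : ∀ w, |H w| ≤ C := fun w => abs_ciSup_le_of_abs_le (abs_signedSum_sub_le hn hL 1 w)
  have hKint : Integrable K (P.prod P) := integrable_of_abs_le hKm fun q => hHC _
  have h1 : ∫ w, H w ∂(Measure.pi fun _ : Fin n => μ.prod μ) = ∫ z, ∫ z', K (z, z') ∂P ∂P := by
    rw [← hmp.integral_comp' H, ← integral_prod K hKint]
    rfl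
  rw [h1]
  refine integral_mono (integrable_of_abs_le h.measurable_supDeviation fun z =>
    abs_ciSup_le_of_abs_le (abs_mean_sub_empirical_mean_le hn hLm hL z))
    hKint.integral_prod_left fun z => ciSup_le fun g => ?_
  have hLint : Integrable (L g) μ := integrable_of_abs_le (hLm g) fun x =>
    abs_le.2 ⟨by linarith [(hL g x).1, (hL g x).2], (hL g x).2⟩
  have hLi : ∀ i : Fin n, Integrable (fun z' : Fin n → Z => L g (z' i)) P := fun i =>
    (measurePreserving_eval (fun _ : Fin n => μ) i).integrable_comp_of_integrable hLint
  have h2 : ∫ z' : Fin n → Z, signedSum 1 (fun i => (1 / (n : ℝ)) * (L g (z' i) - L g (z i))) ∂P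
      = ∫ x, L g x ∂μ - (1 / (n : ℝ)) * ∑ i, L g (z i) := by
    simp only [signedSum, Pi.one_apply, Units.val_one, Int.cast_one, one_mul]
    rw [integral_finsetSum (f := fun i (z' : Fin n → Z) => 1 / (n : ℝ) * (L g (z' i) - L g (z i))) _
      fun i _ => ((hLi i).sub (integrable_const _)).const_mul _]
    have h3 : ∀ i : Fin n, ∫ z' : Fin n → Z, (1 / (n : ℝ)) * (L g (z' i) - L g (z i)) ∂P
        = (1 / (n : ℝ)) * (∫ x, L g x ∂μ - L g (z i)) := by
      intro i
      rw [integral_const_mul, integral_sub (hLi i) (integrable_const _),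
        integral_comp_eval (μ := fun _ : Fin n => μ) (hLm g).aestronglyMeasurable]
      simp
    simp only [h3]
    rw [← Finset.mul_sum, Finset.sum_sub_distrib, mul_sub]
    simp only [Finset.sum_const, Finset.card_univ, Fintype.card_fin, nsmul_eq_mul]
    field_simp
  simp only [← h2]
  refine integral_mono ?_ (integrable_of_abs_le
    (hKm.comp (measurable_const.prodMk measurable_id)) fun z' => hHC _) fun z' => ?_
  · simp only [signedSum]
    exact integrable_finsetSum _ fun i _ =>
      (((hLi i).sub (integrable_const _)).const_mul _).const_mul _
  · exact le_ciSup (f := fun g => signedSum 1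
      (fun i => (1 / (n : ℝ)) * (L g (z' i) - L g (z i))))
      (bddAbove_range_of_abs_le (abs_signedSum_sub_le hn hL 1 fun i => (z i, z' i))) g

/-- Symmetrisation. -/
lemma integral_supDeviation_le [Nonempty I] [IsProbabilityMeasure μ] (hn : 1 ≤ n)
    (h : HasMeasurableSuprema L μ) (hLm : ∀ g, Measurable (L g))
    (hL : ∀ g x, L g x ∈ Set.Icc 0 C) :
    ∫ z : Fin n → Z, supDeviation L μ z ∂(Measure.pi fun _ => μ)
      ≤ 2 * ∫ z : Fin n → Z, empiricalSignAverage L z ∂(Measure.pi fun _ => μ) := by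
  set P : Measure (Fin n → Z) := Measure.pi fun _ => μ
  set S : (Fin n → ℤˣ) → (Fin n → Z) → ℝ := fun σ z =>
    ⨆ g, signedSum σ fun i => (1 / (n : ℝ)) * L g (z i)
  have hSm : ∀ σ, Measurable (S σ) := fun σ => h.measurable_iSup_signedSum σ
  have hSb : ∀ (σ : Fin n → ℤˣ) (z : Fin n → Z) (g : I), |signedSum σ fun i => (1 / (n : ℝ)) * L g (z i)| ≤ C := fun σ z g =>
    abs_signedSum_div_nat_le hn σ fun i => hL g (z i)
  have hSC : ∀ σ z, |S σ z| ≤ C := fun σ z => abs_ciSup_le_of_abs_le (hSb σ z)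
  have hfst : MeasurePreserving (fun (w : Fin n → Z × Z) i => (w i).1)
      (Measure.pi fun _ => μ.prod μ) P :=
    measurePreserving_pi (fun _ => μ.prod μ) (fun _ => μ) fun _ => measurePreserving_fst
  have hsnd : MeasurePreserving (fun (w : Fin n → Z × Z) i => (w i).2)
      (Measure.pi fun _ => μ.prod μ) P :=
    measurePreserving_pi (fun _ => μ.prod μ) (fun _ => μ) fun _ => measurePreserving_snd
  have hSint : ∀ σ, Integrable (S σ) P := fun σ => integrable_of_abs_le (hSm σ) (hSC σ)
  have hcomp : ∀ σ {u : (Fin n → Z × Z) → Fin n → Z},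
      MeasurePreserving u (Measure.pi fun _ => μ.prod μ) P →
      ∫ w, S σ (u w) ∂(Measure.pi fun _ => μ.prod μ) = ∫ z, S σ z ∂P := by
    intro σ u hu
    rw [← hu.map_eq, integral_map hu.measurable.aemeasurable (hSm σ).aestronglyMeasurable]
  -- For each `σ` the signed differences split into a ghost part with signs `σ` and a sample part
  -- with signs `-σ`. Averaging over `σ` makes both equal, whence the factor 2.
  have hσ : ∀ σ : Fin n → ℤˣ, ∫ z, supDeviation L μ z ∂P
      ≤ ∫ z, S σ z ∂P + ∫ z, S (-σ) z ∂P := by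
    intro σ
    refine (integral_supDeviation_le_ghost hn h hLm hL).trans ?_
    have h1 : Integrable (fun w : Fin n → Z × Z => S σ fun i => (w i).2)
        (Measure.pi fun _ => μ.prod μ) := hsnd.integrable_comp_of_integrable (hSint σ)
    have h2 : Integrable (fun w : Fin n → Z × Z => S (-σ) fun i => (w i).1)
        (Measure.pi fun _ => μ.prod μ) := hfst.integrable_comp_of_integrable (hSint (-σ))
    rw [← integral_iSup_signedSum_sub_eq h σ, ← hcomp σ hsnd, ← hcomp (-σ) hfst,
      ← integral_add h1 h2]
    refine integral_mono (integrable_of_abs_le (h.measurable_iSup_signedSum_sub σ) fun w =>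
      abs_ciSup_le_of_abs_le (abs_signedSum_sub_le hn hL σ w))
      (h1.add h2) fun w => ciSup_le fun g => ?_
    have h1 := le_ciSup (bddAbove_range_of_abs_le (hSb σ fun i => (w i).2)) g
    have h2 := le_ciSup (bddAbove_range_of_abs_le (hSb (-σ) fun i => (w i).1)) g
    refine le_trans (le_of_eq ?_) (add_le_add h1 h2)
    rw [signedSum_neg_left]
    simp only [signedSum, ← Finset.sum_neg_distrib, ← Finset.sum_add_distrib]
    exact Finset.sum_congr rfl fun i _ => by ring
  have hsum := Finset.sum_le_sum fun σ (_ : σ ∈ (Finset.univ : Finset (Fin n → ℤˣ))) => hσ σ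
  have hneg := Equiv.sum_comp (Equiv.neg (Fin n → ℤˣ)) fun σ => ∫ z, S σ z ∂P
  simp only [Equiv.neg_apply] at hneg
  rw [Finset.sum_add_distrib, hneg, Finset.sum_const, Finset.card_univ, nsmul_eq_mul] at hsum
  have hemp : ∫ z, empiricalSignAverage L z ∂P
      = (1 / (2 : ℝ) ^ Fintype.card (Fin n)) * ∑ σ, ∫ z, S σ z ∂P := by
    rw [← integral_finsetSum _ fun σ _ => hSint σ, ← integral_const_mul]
    rfl
  rw [hemp]
  have hcard : ((Fintype.card (Fin n → ℤˣ) : ℕ) : ℝ) = 2 ^ Fintype.card (Fin n) := by simp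
  rw [hcard] at hsum
  have hpos : (0 : ℝ) < 2 ^ Fintype.card (Fin n) := by positivity
  rw [← mul_assoc, mul_one_div, div_mul_eq_mul_div, le_div_iff₀ hpos]
  linarith

/-- The Rademacher generalisation bound with the empirical Rademacher average. -/
lemma one_sub_le_measureReal_generalization [Nonempty I] [IsProbabilityMeasure μ] (hn : 1 ≤ n)
    (h : HasMeasurableSuprema L μ) (hLm : ∀ g, Measurable (L g)) (hC0 : 0 < C)
    (hL : ∀ g x, L g x ∈ Set.Icc 0 C) {δ : ℝ} (hδ0 : 0 < δ) (hδ1 : δ < 1) :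
    ∃ E : Set (Fin n → Z), MeasurableSet E ∧ 1 - δ ≤ (Measure.pi fun _ : Fin n => μ).real E ∧
      ∀ z ∈ E, ∀ g, ∫ x, L g x ∂μ ≤ (1 / (n : ℝ)) * ∑ i, L g (z i)
        + 2 * empiricalSignAverage L z + 3 * C * √(Real.log (1 / δ) / (2 * n)) := by
  have hn0 : (0 : ℝ) < n := by exact_mod_cast hn
  -- McDiarmid is applied once, to the difference, so `δ` is not split. Its one-point differences
  -- are at most `C/n + 2C/n`, and symmetrisation makes its mean nonpositive.
  set F : (Fin n → Z) → ℝ := fun z => supDeviation L μ z - 2 * empiricalSignAverage L z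
  have hFm : Measurable F :=
    h.measurable_supDeviation.sub (h.measurable_empiricalSignAverage.const_mul 2)
  have hdev : ∀ z : Fin n → Z, |supDeviation L μ z| ≤ C := fun z =>
    abs_ciSup_le_of_abs_le (abs_mean_sub_empirical_mean_le hn hLm hL z)
  have hemp := abs_empiricalSignAverage_le (L := L) hn hL
  refine ⟨{z | F z ≤ 3 / n * C * n * √(Real.log (1 / δ) / (2 * n))},
    measurableSet_le hFm measurable_const,
    one_sub_le_measureReal_of_bounded_differences μ hn hFm (M := 3 * C) (by positivity) ?_ ?_ ?_
      hδ0 hδ1, ?_⟩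
  · intro z
    have h1 := abs_le.1 (hdev z)
    have h2 := abs_le.1 (hemp z)
    exact abs_le.2 ⟨by linarith [h1.1, h2.2], by linarith [h1.2, h2.1]⟩
  · intro z i x
    have h1 := supDeviation_sub_update_le (μ := μ) hn hLm hL z i x
    have h2 := empiricalSignAverage_update_sub_le (L := L) hn hL z i x
    have h3 : 3 / n * C = 3 * (1 / (n : ℝ) * C) := by ring
    rw [h3]
    linarith
  · rw [integral_sub (integrable_of_abs_le h.measurable_supDeviation hdev)
      ((integrable_of_abs_le h.measurable_empiricalSignAverage hemp).const_mul 2),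
      integral_const_mul]
    linarith [integral_supDeviation_le (n := n) hn h hLm hL]
  · intro z hz g
    have h1 : F z ≤ 3 * C * √(Real.log (1 / δ) / (2 * n)) := by
      refine (show F z ≤ _ from hz).trans (le_of_eq ?_)
      field_simp
    have h2 := le_ciSup (bddAbove_range_of_abs_le
      (abs_mean_sub_empirical_mean_le (μ := μ) hn hLm hL z)) g
    have h3 : F z = supDeviation L μ z - 2 * empiricalSignAverage L z := rfl
    rw [supDeviation] at h3
    linarith

end UniformDeviation

/-! ### Weighted Rademacher averages of the local class -/

section LocalClass

variable {X : Type*} {B : ℝ} {H : Set (X → ℝ)} {m : ℕ}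

lemma empRademacher_eq_signAverage {ι : Type*} [Fintype ι] [DecidableEq ι] (x : ι → X) :
    empRademacher H x
      = 1 / (Fintype.card ι : ℝ) * signAverage fun (h : H) i => (h : X → ℝ) (x i) := by
  rw [← signAverage_mul_left _ (by positivity)]
  simp only [signAverage, signedSum_mul_left]
  rfl

lemma uniformlyBounded_eval {ι : Type*} (hH : ∀ h ∈ H, ∀ x, h x ∈ Set.Icc (-B) B) (x : ι → X) :
    UniformlyBounded fun (h : H) i => (h : X → ℝ) (x i) :=
  ⟨B, fun h i => abs_le.2 (hH h h.2 (x i))⟩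

lemma empRademacher_nonneg [Nonempty H] {ι : Type*} [Fintype ι] [DecidableEq ι]
    (hH : ∀ h ∈ H, ∀ x, h x ∈ Set.Icc (-B) B) (x : ι → X) : 0 ≤ empRademacher H x := by
  rw [empRademacher_eq_signAverage]
  exact mul_nonneg (by positivity) (signAverage_nonneg (uniformlyBounded_eval hH x))

lemma empRademacher_mul_sqrt_le_star (H : Set (X → ℝ)) (x : Fin m → X) {T : Finset (Fin m)}
    (hT : T.Nonempty) :
    empRademacher H (fun i : {i // i ∈ T} => x i) * √((T.card : ℝ) / m) ≤ empRademacherStar H x :=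
  le_ciSup (f := fun T : {T : Finset (Fin m) // T.Nonempty} =>
    empRademacher H (fun i : {i // i ∈ T.1} => x i) * √((T.1.card : ℝ) / m))
    (Set.finite_range _).bddAbove ⟨T, hT⟩

lemma empRademacherStar_nonneg [Nonempty H] (hH : ∀ h ∈ H, ∀ x, h x ∈ Set.Icc (-B) B)
    (x : Fin m → X) : 0 ≤ empRademacherStar H x :=
  Real.iSup_nonneg fun _ => mul_nonneg (empRademacher_nonneg hH _) (Real.sqrt_nonneg _)

/-- The left side is `|T|` times the Rademacher complexity on `T`, while that complexity times
`√(|T|/m)` is one of the terms in the maximum. -/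
lemma signAverage_indicator_le [Nonempty H] (hm : 1 ≤ m) (x : Fin m → X) {T : Finset (Fin m)}
    (hT : T.Nonempty) :
    signAverage (fun (h : H) i => (if i ∈ T then 1 else 0) * (h : X → ℝ) (x i))
      ≤ √(m : ℝ) * empRademacherStar H x * √(T.card : ℝ) := by
  have hm0 : (0 : ℝ) < m := by exact_mod_cast hm
  have hT0 : (0 : ℝ) < T.card := by exact_mod_cast hT.card_pos
  have h := empRademacher_mul_sqrt_le_star H x hT
  rw [signAverage_indicator (fun (h : H) i => (h : X → ℝ) (x i))]
  rw [empRademacher_eq_signAverage, Fintype.card_coe, Real.sqrt_div hT0.le] at h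
  set A := signAverage fun (h : H) (i : {i // i ∈ T}) => (h : X → ℝ) (x i)
  set s := √(T.card : ℝ)
  set t := √(m : ℝ)
  have hs : 0 < s := Real.sqrt_pos.2 hT0
  have ht : 0 < t := Real.sqrt_pos.2 hm0
  have hs2 : (T.card : ℝ) = s * s := (Real.mul_self_sqrt hT0.le).symm
  rw [hs2] at h
  have h2 := mul_le_mul_of_nonneg_left h (mul_pos ht hs).le
  have h3 : t * s * (1 / (s * s) * A * (s / t)) = A := by field_simp
  rw [h3] at h2
  linarith

/-- A Rademacher average with nonnegative weights is controlled by the subset version of the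
empirical Rademacher complexity. -/
lemma signAverage_weighted_le [Nonempty H] (hH : ∀ h ∈ H, ∀ x, h x ∈ Set.Icc (-B) B)
    (hm : 1 ≤ m) (x : Fin m → X) {p : Fin m → ℝ} (hp : ∀ i, 0 ≤ p i) :
    signAverage (fun (h : H) i => p i * (h : X → ℝ) (x i))
      ≤ √(m : ℝ) * empRademacherStar H x * (√(∑ i, p i ^ 2) * (Real.log m + 1)) := by
  have hb := uniformlyBounded_eval hH x
  refine sublinear_le_of_indicator_le
    (fun p => signAverage fun (h : H) i => p i * (h : X → ℝ) (x i)) ?_ ?_ ?_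
    (mul_nonneg (Real.sqrt_nonneg _) (empRademacherStar_nonneg hH x))
    (fun T hT => signAverage_indicator_le hm x hT) p hp
  · simp [signAverage, signedSum]
  · intro p q
    simp only [Pi.add_apply, add_mul]
    exact signAverage_add_le (hb.mul p) (hb.mul q)
  · intro c p hc
    simp only [Pi.smul_apply, smul_eq_mul, mul_assoc]
    exact signAverage_mul_left _ hc

lemma sq_sub_mem_Icc {s t : ℝ} (hs : s ∈ Set.Icc (-B) B) (ht : t ∈ Set.Icc (-B) B) :
    (s - t) ^ 2 ∈ Set.Icc 0 (4 * B ^ 2) :=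
  ⟨sq_nonneg _, by
    have := sq_le_sq' (a := s - t) (b := 2 * B) (by linarith [hs.1, ht.2])
      (by linarith [hs.2, ht.1])
    linarith⟩

/-- Lipschitz constant for the contraction: the factor `s + t - 2r` has absolute value at most `4B`.
-/
lemma abs_sq_sub_sub_sq_sub_le {r s t : ℝ} (hr : r ∈ Set.Icc (-B) B) (hs : s ∈ Set.Icc (-B) B)
    (ht : t ∈ Set.Icc (-B) B) : |(r - s) ^ 2 - (r - t) ^ 2| ≤ 4 * B * |s - t| := by
  have h1 : (r - s) ^ 2 - (r - t) ^ 2 = (s + t - 2 * r) * (s - t) := by ring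
  rw [h1, abs_mul]
  refine mul_le_mul_of_nonneg_right (abs_le.2 ⟨?_, ?_⟩) (abs_nonneg _)
  · linarith [hs.1, ht.1, hr.2]
  · linarith [hs.2, ht.2, hr.1]

lemma uniformlyBounded_sq_sub {ι : Type*} (hH : ∀ h ∈ H, ∀ x, h x ∈ Set.Icc (-B) B) {f : X → ℝ}
    (hf : ∀ x, f x ∈ Set.Icc (-B) B) (x : ι → X) :
    UniformlyBounded fun (h : H) i => (f (x i) - (h : X → ℝ) (x i)) ^ 2 :=
  ⟨4 * B ^ 2, fun h i => by
    have := sq_sub_mem_Icc (hf (x i)) (hH h h.2 (x i))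
    rw [abs_of_nonneg this.1]
    exact this.2⟩

lemma signAverage_weighted_sq_le [Nonempty H] (hB : 0 < B)
    (hH : ∀ h ∈ H, ∀ x, h x ∈ Set.Icc (-B) B) {f : X → ℝ} (hf : ∀ x, f x ∈ Set.Icc (-B) B)
    (hm : 1 ≤ m) (x : Fin m → X) {p : Fin m → ℝ} (hp : ∀ i, 0 ≤ p i) :
    signAverage (fun (h : H) i => p i * (f (x i) - (h : X → ℝ) (x i)) ^ 2)
      ≤ 4 * B * (√(m : ℝ) * empRademacherStar H x * (√(∑ i, p i ^ 2) * (Real.log m + 1))) := by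
  have h1 : signAverage (fun (h : H) i => p i * (f (x i) - (h : X → ℝ) (x i)) ^ 2)
      ≤ signAverage (fun (h : H) i => 4 * B * (p i * (h : X → ℝ) (x i))) := by
    -- Contraction is applied coordinatewise with the weight kept inside: `p i ≥ 0` scales both
    -- sides of the Lipschitz bound equally.
    refine signAverage_contraction (((uniformlyBounded_eval hH x).mul p).mul fun _ => 4 * B)
      ((uniformlyBounded_sq_sub hH hf x).mul p) fun h k i => ?_
    rw [← mul_sub, ← mul_sub, ← mul_sub, abs_mul, abs_mul (4 * B), abs_mul (p i),
      abs_of_nonneg (hp i), abs_of_pos (by positivity : 0 < 4 * B), mul_left_comm]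
    exact mul_le_mul_of_nonneg_left
      (abs_sq_sub_sub_sq_sub_le (hf _) (hH h h.2 _) (hH k k.2 _)) (hp i)
  rw [signAverage_mul_left _ (by positivity)] at h1
  exact h1.trans (mul_le_mul_of_nonneg_left (signAverage_weighted_le hH hm x hp) (by positivity))

lemma abs_signedSum_weighted_le (hH : ∀ h ∈ H, ∀ x, h x ∈ Set.Icc (-B) B) {f : X → ℝ}
    (hf : ∀ x, f x ∈ Set.Icc (-B) B) (x : Fin m → X) (σ : Fin m → ℤˣ) {p : Fin m → ℝ}
    (hp : ∀ i, 0 ≤ p i) (h : H) :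
    |signedSum σ fun i => p i * (f (x i) - (h : X → ℝ) (x i)) ^ 2| ≤ ∑ i, p i * (4 * B ^ 2) := by
  refine (abs_signedSum_le _ _).trans (Finset.sum_le_sum fun i _ => ?_)
  have h1 := sq_sub_mem_Icc (hf (x i)) (hH h h.2 (x i))
  rw [abs_of_nonneg (mul_nonneg (hp i) h1.1)]
  exact mul_le_mul_of_nonneg_left h1.2 (hp i)

/-- A supremum of linear functions of `p` is lower semicontinuous, so measurability holds even for
an uncountable local class with no regularity. -/
lemma measurable_iSup_signedSum_weighted (hH : ∀ h ∈ H, ∀ x, h x ∈ Set.Icc (-B) B) {f : X → ℝ}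
    (hf : ∀ x, f x ∈ Set.Icc (-B) B) (x : Fin m → X) (σ : Fin m → ℤˣ) :
    Measurable fun p : Fin m → ℝ =>
      ⨆ h : H, signedSum σ fun i => p i * (f (x i) - (h : X → ℝ) (x i)) ^ 2 := by
  refine (lowerSemicontinuous_ciSup (fun p => bddAbove_signedSum
    ((uniformlyBounded_sq_sub hH hf x).mul p) σ) fun h => Continuous.lowerSemicontinuous ?_).measurable
  unfold signedSum
  fun_prop

end LocalClass

/-! ### Mirrored neighborhood fidelity -/

section Fidelity

variable {X : Type*} [MeasurableSpace X] {ν : Measure X} {N : Kernel X X} {B : ℝ} {f : X → ℝ}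
  {H : Set (X → ℝ)} {m : ℕ}

lemma measurable_nbhdDensity (x : X) : Measurable (nbhdDensity N ν x) :=
  (Measure.measurable_rnDeriv _ _).ennreal_toReal

lemma nbhdDensity_nonneg (x x' : X) : 0 ≤ nbhdDensity N ν x x' := ENNReal.toReal_nonneg

lemma disjointednessFactor_eq (x : Fin m → X) :
    disjointednessFactor N ν x
      = √(1 / (m : ℝ)) * ∫ x', √(∑ i, nbhdDensity N ν (x i) x' ^ 2) ∂ν := by
  rw [disjointednessFactor, ← integral_const_mul]
  simp only [Real.sqrt_mul (by positivity : (0 : ℝ) ≤ 1 / m)]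

lemma sqrt_sum_sq_le_sum {p : Fin m → ℝ} (hp : ∀ i, 0 ≤ p i) : √(∑ i, p i ^ 2) ≤ ∑ i, p i :=
  Real.sqrt_le_iff.2 ⟨Finset.sum_nonneg fun i _ => hp i,
    Finset.sum_sq_le_sq_sum_of_nonneg fun i _ => hp i⟩

variable [IsMarkovKernel N]

lemma integrable_nbhdDensity (x : X) : Integrable (nbhdDensity N ν x) ν :=
  Measure.integrable_toReal_rnDeriv

lemma integrable_sqrt_sum_sq_nbhdDensity (x : Fin m → X) :
    Integrable (fun x' => √(∑ i, nbhdDensity N ν (x i) x' ^ 2)) ν := by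
  refine Integrable.mono' (integrable_finsetSum Finset.univ fun i _ =>
    integrable_nbhdDensity (N := N) (ν := ν) (x i)) ?_ (Filter.Eventually.of_forall fun x' => ?_)
  · exact (Finset.measurable_sum _ fun i _ =>
      (measurable_nbhdDensity (x i)).pow_const 2).sqrt.aestronglyMeasurable
  · rw [Real.norm_of_nonneg (Real.sqrt_nonneg _)]
    exact sqrt_sum_sq_le_sum fun i => nbhdDensity_nonneg _ _

lemma measurable_mnfAt (hf : Measurable f) {g : X → X → ℝ}
    (hg : Measurable (Function.uncurry g)) : Measurable (mnfAt N f g) := by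
  have h : Measurable (Function.uncurry fun x x' => (f x - g x' x) ^ 2) :=
    ((hf.comp measurable_fst).sub (hg.comp measurable_swap)).pow_const 2
  exact h.stronglyMeasurable.integral_kernel_prod_right.measurable

lemma measurable_sq_sub_section {g : X → X → ℝ} (hg : Measurable (Function.uncurry g)) (x : X) :
    Measurable fun x' => (f x - g x' x) ^ 2 :=
  (measurable_const.sub (hg.comp measurable_prodMk_right)).pow_const 2

lemma mnfAt_mem_Icc (hf : ∀ x, f x ∈ Set.Icc (-B) B) {g : X → X → ℝ}
    (hg : Measurable (Function.uncurry g)) (hgB : ∀ x' x, g x' x ∈ Set.Icc (-B) B) (x : X) :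
    mnfAt N f g x ∈ Set.Icc 0 (4 * B ^ 2) :=
  integral_mem_Icc (measurable_sq_sub_section hg x) fun x' => sq_sub_mem_Icc (hf x) (hgB x' x)

lemma integrable_iSup_signedSum_nbhdDensity [Nonempty H]
    (hH : ∀ h ∈ H, ∀ x, h x ∈ Set.Icc (-B) B) (hf : ∀ x, f x ∈ Set.Icc (-B) B)
    (x : Fin m → X) (σ : Fin m → ℤˣ) :
    Integrable (fun x' => ⨆ h : H, signedSum σ fun i =>
      nbhdDensity N ν (x i) x' * (f (x i) - (h : X → ℝ) (x i)) ^ 2) ν := by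
  refine Integrable.mono' (integrable_finsetSum Finset.univ fun i _ =>
    (integrable_nbhdDensity (N := N) (ν := ν) (x i)).mul_const (4 * B ^ 2)) ?_
    (Filter.Eventually.of_forall fun x' => abs_ciSup_le_of_abs_le fun h =>
      abs_signedSum_weighted_le hH hf x σ (fun i => nbhdDensity_nonneg _ _) h)
  exact ((measurable_iSup_signedSum_weighted hH hf x σ).comp
    (measurable_pi_iff.2 fun i => measurable_nbhdDensity (x i))).aestronglyMeasurable

variable [SigmaFinite ν]

lemma mnfAt_eq_integral_nbhdDensity {x : X} (hN : N x ≪ ν) (g : X → X → ℝ) :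
    mnfAt N f g x = ∫ x', nbhdDensity N ν x x' * (f x - g x' x) ^ 2 ∂ν := by
  rw [mnfAt, ← integral_rnDeriv_smul hN]
  rfl

/-- The passage from explainers to local functions: at each `x'` the same function `g x' ∈ H` enters
all `m` summands, so the integrand is bounded pointwise by the supremum over `H`. -/
lemma signedSum_mnfAt_le [Nonempty H] (hN : ∀ x, N x ≪ ν)
    (hH : ∀ h ∈ H, ∀ x, h x ∈ Set.Icc (-B) B) (hf : ∀ x, f x ∈ Set.Icc (-B) B)
    (x : Fin m → X) (σ : Fin m → ℤˣ) {g : X → X → ℝ} (hg : Measurable (Function.uncurry g))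
    (hgH : ∀ x', g x' ∈ H) :
    (signedSum σ fun i => mnfAt N f g (x i)) ≤ ∫ x', ⨆ h : H, signedSum σ (fun i =>
      nbhdDensity N ν (x i) x' * (f (x i) - (h : X → ℝ) (x i)) ^ 2) ∂ν := by
  have hint : ∀ i, Integrable (fun x' => ((σ i : ℤ) : ℝ) *
      (nbhdDensity N ν (x i) x' * (f (x i) - g x' (x i)) ^ 2)) ν := fun i => by
    refine Integrable.const_mul ?_ _
    refine (integrable_nbhdDensity (x i)).mul_bdd (c := 4 * B ^ 2)
      (measurable_sq_sub_section hg (x i)).aestronglyMeasurable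
      (Filter.Eventually.of_forall fun x' => ?_)
    have := sq_sub_mem_Icc (hf (x i)) (hH _ (hgH x') (x i))
    rw [Real.norm_of_nonneg this.1]
    exact this.2
  simp only [signedSum, mnfAt_eq_integral_nbhdDensity (hN _), ← integral_const_mul]
  rw [← integral_finsetSum _ fun i _ => hint i]
  refine integral_mono (integrable_finsetSum _ fun i _ => hint i)
    (integrable_iSup_signedSum_nbhdDensity hH hf x σ) fun x' => ?_
  exact le_ciSup (bddAbove_range_of_abs_le fun h : H => abs_signedSum_weighted_le hH hf x σ
    (fun i => nbhdDensity_nonneg (N := N) (ν := ν) (x i) x') h) ⟨g x', hgH x'⟩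

/-- The empirical Rademacher average of the fidelity losses is controlled by the disjointedness
factor and the complexity of the local class. -/
lemma signAverage_mnfAt_le {G : Set (X → X → ℝ)} [Nonempty G] [Nonempty H] (hB : 0 < B)
    (hN : ∀ x, N x ≪ ν) (hH : ∀ h ∈ H, ∀ x, h x ∈ Set.Icc (-B) B)
    (hf : ∀ x, f x ∈ Set.Icc (-B) B) (hG : ∀ g ∈ G, ∀ x', g x' ∈ H)
    (hGm : ∀ g ∈ G, Measurable (Function.uncurry g)) (hm : 1 ≤ m) (x : Fin m → X) :
    signAverage (fun (g : G) i => (1 / (m : ℝ)) * mnfAt N f g (x i))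
      ≤ 4 * B * disjointednessFactor N ν x * empRademacherStar H x * (Real.log m + 1) := by
  have hm0 : (0 : ℝ) < m := by exact_mod_cast hm
  have hint := fun σ => integrable_iSup_signedSum_nbhdDensity (N := N) (ν := ν) hH hf x σ
  have h1 : signAverage (fun (g : G) i => mnfAt N f g (x i))
      ≤ ∫ x', signAverage (fun (h : H) i =>
        nbhdDensity N ν (x i) x' * (f (x i) - (h : X → ℝ) (x i)) ^ 2) ∂ν := by
    simp only [signAverage]
    rw [integral_const_mul, integral_finsetSum _ fun σ _ => hint σ]
    refine mul_le_mul_of_nonneg_left (Finset.sum_le_sum fun σ _ => ciSup_le fun g => ?_)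
      (by positivity)
    exact signedSum_mnfAt_le hN hH hf x σ (hGm g g.2) (hG g g.2)
  have h2 : ∫ x', signAverage (fun (h : H) i =>
        nbhdDensity N ν (x i) x' * (f (x i) - (h : X → ℝ) (x i)) ^ 2) ∂ν
      ≤ ∫ x', 4 * B * (√(m : ℝ) * empRademacherStar H x *
        (√(∑ i, nbhdDensity N ν (x i) x' ^ 2) * (Real.log m + 1))) ∂ν :=
    integral_mono ((integrable_finsetSum _ fun σ _ => hint σ).const_mul _)
      ((((integrable_sqrt_sum_sq_nbhdDensity x).mul_const _).const_mul _).const_mul _)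
      fun x' => signAverage_weighted_sq_le hB hH hf hm x fun i => nbhdDensity_nonneg _ _
  rw [integral_const_mul, integral_const_mul, integral_mul_const] at h2
  rw [signAverage_mul_left _ (by positivity), disjointednessFactor_eq]
  refine (mul_le_mul_of_nonneg_left (h1.trans h2) (by positivity)).trans (le_of_eq ?_)
  -- The `1/m` of the empirical mean and the `√m` of the weighted bound combine to the normalisation
  -- inside the disjointedness factor.
  have h3 : 1 / (m : ℝ) * √(m : ℝ) = √(1 / (m : ℝ)) := by
    rw [Real.sqrt_div zero_le_one, Real.sqrt_one]
    have := Real.mul_self_sqrt hm0.le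
    have hs : 0 < √(m : ℝ) := Real.sqrt_pos.2 hm0
    field_simp
    linarith
  rw [← h3]
  ring

end Fidelity

/-! ### The generalisation bound for mirrored neighborhood fidelity -/

theorem theorem2 {X : Type*} [MeasurableSpace X]
    (ν : Measure X) [SigmaFinite ν]
    (D : Measure (X × ℝ)) [IsProbabilityMeasure D]
    (N : Kernel X X) [IsMarkovKernel N] (hN : ∀ x, N x ≪ ν)
    (B : ℝ) (hB : 0 < B)
    (f : X → ℝ) (hf : Measurable f) (hfB : ∀ x, f x ∈ Set.Icc (-B) B)
    (Glocal : Set (X → ℝ)) (hGlocal : ∀ h ∈ Glocal, ∀ x, h x ∈ Set.Icc (-B) B)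
    (G : Set (X → X → ℝ)) (hG : ∀ g ∈ G, ∀ x', g x' ∈ Glocal)
    (hGmeas : ∀ g ∈ G, Measurable (Function.uncurry g))
    (hsup : MeasurableSuprema D N f G)
    (m : ℕ) (hm : 1 ≤ m) (δ : ℝ) (hδ0 : 0 < δ) (hδ1 : δ < 1) :
    ∃ E : Set (Fin m → X × ℝ), MeasurableSet E ∧
      1 - δ ≤ (Measure.pi fun _ : Fin m => D).real E ∧
      ∀ S ∈ E, ∀ g ∈ G,
        mnf D N f g ≤
          trainMnf N f g (fun i => (S i).1)
            + 8 * B * disjointednessFactor N ν (fun i => (S i).1)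
                * empRademacherStar Glocal (fun i => (S i).1) * (Real.log m + 1)
            + 12 * B ^ 2 * Real.sqrt (Real.log (1 / δ) / (2 * m)) := by
  rcases G.eq_empty_or_nonempty with rfl | hne
  · exact ⟨Set.univ, MeasurableSet.univ, by simpa using hδ0.le, by simp⟩
  have : Nonempty G := hne.to_subtype
  -- A probability measure lives on a nonempty space; a source point is needed to produce a member
  -- `g₀ x₀` of the local class.
  obtain ⟨⟨x₀, -⟩⟩ : Nonempty (X × ℝ) := D.nonempty_of_neZero
  obtain ⟨g₀, hg₀⟩ := hne
  have : Nonempty Glocal := ⟨⟨g₀ x₀, hG g₀ hg₀ x₀⟩⟩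
  have hgB : ∀ g ∈ G, ∀ x' x, g x' x ∈ Set.Icc (-B) B := fun g hg x' =>
    hGlocal _ (hG g hg x')
  have hLm : ∀ g : G, Measurable fun z : X × ℝ => mnfAt N f g z.1 := fun g =>
    (measurable_mnfAt hf (hGmeas g g.2)).comp measurable_fst
  obtain ⟨E, hE, hED, hbound⟩ := one_sub_le_measureReal_generalization (μ := D) (C := 4 * B ^ 2)
    (L := fun (g : G) z => mnfAt N f g z.1) hm
    -- The losses ignore labels, so measurability in the inputs transfers to labelled samples by
    -- projection.
    (fun k a₀ a => (hsup k a₀ a).comp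
      (measurable_pi_iff.2 fun i => (measurable_pi_apply i).fst))
    hLm (by positivity)
    (fun g z => mnfAt_mem_Icc hfB (hGmeas g g.2) (hgB g g.2) z.1) hδ0 hδ1
  refine ⟨E, hE, hED, fun S hS g hg => ?_⟩
  have h1 := hbound S hS ⟨g, hg⟩
  have h2 := signAverage_mnfAt_le (N := N) (ν := ν) hB hN hGlocal hfB hG hGmeas hm
    fun i => (S i).1
  have h3 : 3 * (4 * B ^ 2) = 12 * B ^ 2 := by ring
  rw [h3] at h1
  simp only [empiricalSignAverage] at h1
  simp only [mnf, trainMnf]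
  linarith
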